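/- Let $n_\theta>0$, $\omega_0>0$, $c>0$, $k_f>0$ and $k_p,k_d\in\mathbb R$. For functions $h:\mathbb R\to\mathbb R$ (the nonlinearity) and $m_w$ (the external disturbance), consider the closed-loop system $$\ddot\theta+2n_\theta\dot\theta+\omega_0^2\theta=h(\dot\delta_f)+m_w(t),\qquad \dot\delta_f+c\,\delta_f=-k_p\theta-k_d\dot\theta,$$ with state $x=(\theta,\dot\theta,\delta_f)^\top\in\mathbb R^3$. Suppose that $$\operatorname{Re}\widetilde W(j\omega)+\frac1{k_f}>0\quad\text{for all }\omega\in\mathbb R,\qquad \widetilde W(s)=\frac{s\,(k_d s+k_p)}{(s+c)(s^2+2n_\theta s+\omega_0^2)}.$$ Then there exist a symmetric positive definite matrix $P\in\mathbb R^{3\times3}$ and constants $\varepsilon>0$, $K>0$, depending only on $n_\theta,\omega_0,c,k_p,k_d,k_f$ (and neither on $h$ nor on $m_w$), such that for every $h$ satisfying the slope restriction $$0\le\frac{h(\omega_1)-h(\omega_2)}{\omega_1-\omega_2}\le k_f\qquad\text{for all }\omega_1\ne\omega_2$$ the system is incrementally stable (strongly contracting) in the following sense. For every disturbance $m_w$ and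 every two (classical) solutions $x,\tilde x$ of the system on a common time interval $I$ with this same $m_w$, the difference $\Delta x=x-\tilde x$ and the function $V(\Delta x)=\Delta x^\top P\,\Delta x$ satisfy $$\frac{d}{dt}V(\Delta x(t))\le-\varepsilon\,V(\Delta x(t))\quad\text{for all }t\in I,$$ and $$\|\Delta x(t)\|\le K e^{-\frac{\varepsilon}{2}(t-s)}\|\Delta x(s)\|\quad\text{for all }s\le t\text{ in }I.$$ -/

import Mathlib

namespace FinRoll

open Matrix

/-- The constants of the linear part: `n` is the roll damping `n_θ`, `ω₀` the natural roll
frequency, `c` the fin-angle damping, `kp` and `kd` the gains of the controller. -/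
structure Params where
  n : ℝ
  ω₀ : ℝ
  c : ℝ
  kp : ℝ
  kd : ℝ

/-- `W̃(s) = s (k_d s + k_p) / ((s + c) (s² + 2 n_θ s + ω₀²))`. -/
noncomputable def Wtilde (p : Params) (s : ℂ) : ℂ :=
  s * ((p.kd : ℂ) * s + (p.kp : ℂ)) /
    ((s + (p.c : ℂ)) * (s ^ 2 + 2 * (p.n : ℂ) * s + (p.ω₀ : ℂ) ^ 2))

/-- Slope restriction `0 ≤ (h(ω₁) - h(ω₂)) / (ω₁ - ω₂) ≤ k_f` for all `ω₁ ≠ ω₂`. -/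
def SlopeRestricted (kf : ℝ) (h : ℝ → ℝ) : Prop :=
  ∀ ω₁ ω₂ : ℝ, ω₁ ≠ ω₂ →
    0 ≤ (h ω₁ - h ω₂) / (ω₁ - ω₂) ∧ (h ω₁ - h ω₂) / (ω₁ - ω₂) ≤ kf

/-- `(θ, δ)` solves, on the time interval `I`, the closed-loop system
`θ'' + 2 n_θ θ' + ω₀² θ = h(δ') + m`, `δ' + c δ = -k_p θ - k_d θ'`,
where `θ₁ = θ'` is the roll rate, `θ₂ = θ''` the roll acceleration and `δ₁ = δ'` the fin rate
(one-sided derivatives at end points of `I` that belong to `I`). -/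
structure IsSolutionOn (p : Params) (h m : ℝ → ℝ) (I : Set ℝ)
    (θ θ₁ θ₂ δ δ₁ : ℝ → ℝ) : Prop where
  roll_rate : ∀ t ∈ I, HasDerivWithinAt θ (θ₁ t) I t
  roll_acc : ∀ t ∈ I, HasDerivWithinAt θ₁ (θ₂ t) I t
  fin_rate : ∀ t ∈ I, HasDerivWithinAt δ (δ₁ t) I t
  roll_eq : ∀ t ∈ I, θ₂ t + 2 * p.n * θ₁ t + p.ω₀ ^ 2 * θ t = h (δ₁ t) + m t
  fin_eq : ∀ t ∈ I, δ₁ t + p.c * δ t = -p.kp * θ t - p.kd * θ₁ t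

/-- `x : ℝ → ℝ³` is a state trajectory `x = (θ, θ', δ)` of the closed-loop system with
nonlinearity `h` and disturbance `m` on the time interval `I`. -/
def IsTrajectoryOn (p : Params) (h m : ℝ → ℝ) (I : Set ℝ)
    (x : ℝ → EuclideanSpace ℝ (Fin 3)) : Prop :=
  ∃ θ θ₁ θ₂ δ δ₁ : ℝ → ℝ, IsSolutionOn p h m I θ θ₁ θ₂ δ δ₁ ∧
    ∀ t ∈ I, x t = !₂[θ t, θ₁ t, δ t]

/-- The quadratic form `V(z) = zᵀ P z`. -/
noncomputable def quadForm (P : Matrix (Fin 3) (Fin 3) ℝ) (z : EuclideanSpace ℝ (Fin 3)) : ℝ :=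
  z.ofLp ⬝ᵥ (P *ᵥ z.ofLp)

/-- `V(z) = zᵀ P z` is an incremental Lyapunov function with rate `ε` for the system with
nonlinearity `h`: `d/dt V(x - x') ≤ -ε V(x - x')` along every two trajectories `x`, `x'` that
correspond to the same disturbance. -/
def IsIncrementalLyapunov (p : Params) (h : ℝ → ℝ) (P : Matrix (Fin 3) (Fin 3) ℝ)
    (ε : ℝ) : Prop :=
  ∀ (m : ℝ → ℝ) (I : Set ℝ), I.OrdConnected → ∀ x x' : ℝ → EuclideanSpace ℝ (Fin 3),
    IsTrajectoryOn p h m I x → IsTrajectoryOn p h m I x' →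
      ∀ t ∈ I, ∃ D : ℝ,
        HasDerivWithinAt (fun τ => quadForm P (x τ - x' τ)) D I t ∧
          D ≤ -ε * quadForm P (x t - x' t)

/-- Exponential incremental stability with overshoot `K` and rate `r`, uniformly in the
disturbance, the initial time and the pair of trajectories. -/
def IsIncrementallyExpStable (p : Params) (h : ℝ → ℝ) (K r : ℝ) : Prop :=
  ∀ (m : ℝ → ℝ) (I : Set ℝ), I.OrdConnected → ∀ x x' : ℝ → EuclideanSpace ℝ (Fin 3),
    IsTrajectoryOn p h m I x → IsTrajectoryOn p h m I x' →
      ∀ s ∈ I, ∀ t ∈ I, s ≤ t → ‖x t - x' t‖ ≤ K * Real.exp (-r * (t - s)) * ‖x s - x' s‖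

end FinRoll

/-! The disturbance cancels in the difference of two trajectories. That difference solves the linear
part with input `u`, the increment of `h`, and the slope restriction becomes the sector condition `u
(y - u / kf) ≥ 0`, `y` being the increment of the fin rate. So it suffices to solve the matrix
inequality `IsStorage`, which involves neither `h` nor the disturbance: its solution `P` makes `V`
decay, and Gronwall's argument finishes.

`P` is found by an explicit Kalman-Yakubovich-Popov construction. If `kp ≠ c kd`, the linear part is
controllable. In phase variables the frequency condition says that a cubic in `ω²` is positive; a
small multiple of `1 + ω² + ω⁴` is subtracted, the rest is factored as `|g(iω)|²`, and the
dissipation is a square built from `g`. If `kp = c kd`, the mode `s + c` is uncontrollable and `P`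
is an oscillator energy with corrections.

`P > 0` follows by comparison with a Lyapunov matrix of the linear part at `u = 0`. -/

namespace FinRoll

open Matrix

/-! ### Spectral factorization of positive polynomials -/

/-- A cubic with positive leading coefficient which is positive on `[0, ∞)` has a factor `t + α`
with `α > 0`. -/
theorem exists_cubic_root {k q₂ q₁ q₀ : ℝ} (hk : 0 < k)
    (hq : ∀ t : ℝ, 0 ≤ t → 0 < k * t ^ 3 + q₂ * t ^ 2 + q₁ * t + q₀) :
    ∃ α : ℝ, 0 < α ∧ -k * α ^ 3 + q₂ * α ^ 2 - q₁ * α + q₀ = 0 := by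
  -- This is the cubic at `-α`. It is positive at `0` and nonpositive at a Cauchy-type root bound
  -- `R`.
  set f : ℝ → ℝ := fun α => -k * α ^ 3 + q₂ * α ^ 2 - q₁ * α + q₀ with hf
  have hq0 : 0 < q₀ := by simpa using hq 0 le_rfl
  set S : ℝ := |q₂| + |q₁| + |q₀| with hS
  have hS0 : 0 ≤ S := by positivity
  set R : ℝ := 1 + S / k with hR
  have hR1 : 1 ≤ R := by rw [hR]; linarith [div_nonneg hS0 hk.le]
  have hkR : k * R = k + S := by rw [hR]; field_simp
  have hfR : f R ≤ 0 := by
    have h2 : q₂ * R ^ 2 ≤ |q₂| * R ^ 2 := by gcongr; exact le_abs_self _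
    have h1 : -q₁ * R ≤ |q₁| * R ^ 2 :=
      calc -q₁ * R ≤ |q₁| * R := by gcongr; exact neg_le_abs _
        _ ≤ |q₁| * R ^ 2 := by gcongr; nlinarith
    have h0 : q₀ ≤ |q₀| * R ^ 2 :=
      calc q₀ ≤ |q₀| * 1 := by rw [mul_one]; exact le_abs_self _
        _ ≤ |q₀| * R ^ 2 := by gcongr; nlinarith
    have h3 : k * R ^ 3 = (k + S) * R ^ 2 := by rw [← hkR]; ring
    have h4 : 0 ≤ k * R ^ 2 := by positivity
    simp only [hf]
    rw [hS] at h3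
    linarith
  have hcont : ContinuousOn f (Set.Icc 0 R) := by
    apply Continuous.continuousOn
    fun_prop
  obtain ⟨α, hα, hα0⟩ := intermediate_value_Icc' (zero_le_one.trans hR1) hcont
    (show (0 : ℝ) ∈ Set.Icc (f R) (f 0) from ⟨hfR, by simp [hf, hq0.le]⟩)
  refine ⟨α, lt_of_le_of_ne hα.1 ?_, hα0⟩
  rintro rfl
  simp [hf] at hα0
  linarith

/-- Spectral factorization: an even sextic `q(ω²)` which is positive on the real line equals
`|g₃ s³ + g₂ s² + g₁ s + g₀|²` at `s = iω`. -/
theorem exists_spectral_factor {k q₂ q₁ q₀ : ℝ} (hk : 0 < k)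
    (hq : ∀ t : ℝ, 0 ≤ t → 0 < k * t ^ 3 + q₂ * t ^ 2 + q₁ * t + q₀) :
    ∃ g₃ g₂ g₁ g₀ : ℝ, g₃ ^ 2 = k ∧ g₂ ^ 2 - 2 * g₁ * g₃ = q₂ ∧
      g₁ ^ 2 - 2 * g₀ * g₂ = q₁ ∧ g₀ ^ 2 = q₀ := by
  obtain ⟨α, hα, hroot⟩ := exists_cubic_root hk hq
  obtain ⟨β, hβ⟩ : ∃ β, β = q₂ / k - α := ⟨_, rfl⟩
  obtain ⟨γ, hγ⟩ : ∃ γ, γ = q₁ / k - α * β := ⟨_, rfl⟩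
  have e2 : q₂ = k * (β + α) := by rw [hβ]; field_simp; ring
  have e1 : q₁ = k * (γ + α * β) := by rw [hγ]; field_simp; ring
  have e0 : q₀ = k * (α * γ) := by
    rw [e2, e1] at hroot
    linear_combination hroot
  have hq0 : 0 < q₀ := by simpa using hq 0 le_rfl
  have hγ0 : 0 < γ := by
    rw [e0] at hq0
    exact pos_of_mul_pos_right (pos_of_mul_pos_right hq0 hk.le) hα.le
  obtain ⟨w, hw, hwγ⟩ : ∃ w : ℝ, 0 < w ∧ w ^ 2 = γ :=
    ⟨√γ, Real.sqrt_pos.2 hγ0, Real.sq_sqrt hγ0.le⟩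
  -- The cubic is `k (t + α) (t² + β t + γ)`; at `t = w = √γ` the last factor equals `w (β + 2 w)`.
  have hβw : 0 < β + 2 * w := by
    have h := hq w hw.le
    have h' : k * w ^ 3 + q₂ * w ^ 2 + q₁ * w + q₀ = (k * (w + α) * w) * (β + 2 * w) := by
      rw [e2, e1, e0, ← hwγ]; ring
    rw [h'] at h
    exact pos_of_mul_pos_right h (by positivity)
  obtain ⟨r, hr⟩ : ∃ r : ℝ, r ^ 2 = α := ⟨√α, Real.sq_sqrt hα.le⟩
  obtain ⟨v, hv⟩ : ∃ v : ℝ, v ^ 2 = β + 2 * w := ⟨_, Real.sq_sqrt hβw.le⟩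
  obtain ⟨l, hl⟩ : ∃ l : ℝ, l ^ 2 = k := ⟨√k, Real.sq_sqrt hk.le⟩
  -- Coefficients of `l (s + r) (s² + v s + w)`: at `s = iω`, `t = ω²`, the factors have squared
  -- moduli `t + α` and `t² + β t + γ`.
  refine ⟨l, l * (v + r), l * (w + r * v), l * (r * w), hl, ?_, ?_, ?_⟩
  · rw [e2, ← hl, ← hr]; linear_combination l ^ 2 * hv
  · rw [e1, ← hl, ← hr, ← hwγ]; linear_combination l ^ 2 * r ^ 2 * hv
  · rw [e0, ← hl, ← hr, ← hwγ]; ring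

/-- The positivity of a cubic on `[0, ∞)` is robust under perturbations of lower degree. -/
theorem exists_cubic_margin {k q₂ q₁ q₀ : ℝ} (hk : 0 < k)
    (hq : ∀ t : ℝ, 0 ≤ t → 0 < k * t ^ 3 + q₂ * t ^ 2 + q₁ * t + q₀) :
    ∃ η : ℝ, 0 < η ∧ ∀ t : ℝ, 0 ≤ t →
      0 < k * t ^ 3 + (q₂ - η) * t ^ 2 + (q₁ - η) * t + (q₀ - η) := by
  -- The `3` absorbs the perturbation for `t ≥ R`, as `η (1 + t + t²) ≤ 3 t²` when `η ≤ 1 ≤ t`. On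
  -- `[0, R]` the positive minimum of the cubic absorbs it.
  set S : ℝ := |q₂| + |q₁| + |q₀| + 3 with hS
  have hS0 : 0 < S := by positivity
  set R : ℝ := 1 + S / k with hR
  have hR1 : 1 ≤ R := by rw [hR]; linarith [div_nonneg hS0.le hk.le]
  have hkR : k * R = k + S := by rw [hR]; field_simp
  have hcont : ContinuousOn (fun t : ℝ => k * t ^ 3 + q₂ * t ^ 2 + q₁ * t + q₀)
      (Set.Icc 0 R) := by
    apply Continuous.continuousOn
    fun_prop
  obtain ⟨t₀, ht₀, hmin⟩ := isCompact_Icc.exists_isMinOn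
    (Set.nonempty_Icc.2 (zero_le_one.trans hR1)) hcont
  obtain ⟨μ, hμ⟩ : ∃ μ, μ = k * t₀ ^ 3 + q₂ * t₀ ^ 2 + q₁ * t₀ + q₀ := ⟨_, rfl⟩
  have hμ0 : 0 < μ := hμ ▸ hq t₀ ht₀.1
  have hD : 0 < 1 + R + R ^ 2 := by positivity
  obtain ⟨η, hη0, hη1, hηD⟩ : ∃ η : ℝ, 0 < η ∧ η ≤ 1 ∧ η * (1 + R + R ^ 2) < μ := by
    refine ⟨min 1 (μ / (1 + R + R ^ 2) / 2), by positivity, min_le_left _ _, ?_⟩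
    calc _ ≤ μ / (1 + R + R ^ 2) / 2 * (1 + R + R ^ 2) := by
          gcongr; exact min_le_right _ _
      _ = μ / 2 := by field_simp
      _ < μ := by linarith
  refine ⟨η, hη0, fun t ht => ?_⟩
  rcases le_total t R with htR | htR
  · have h1 : μ ≤ k * t ^ 3 + q₂ * t ^ 2 + q₁ * t + q₀ := by
      rw [hμ]; exact hmin ⟨ht, htR⟩
    have h2 : η * (1 + t + t ^ 2) ≤ η * (1 + R + R ^ 2) := by gcongr
    linarith
  · have ht1 : 1 ≤ t := hR1.trans htR
    have htt : t ≤ t ^ 2 := by nlinarith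
    have h2 : -q₂ * t ^ 2 ≤ |q₂| * t ^ 2 := by gcongr; exact neg_le_abs _
    have h1 : -q₁ * t ≤ |q₁| * t ^ 2 :=
      calc -q₁ * t ≤ |q₁| * t := by gcongr; exact neg_le_abs _
        _ ≤ |q₁| * t ^ 2 := by gcongr
    have h0 : -q₀ ≤ |q₀| * t ^ 2 :=
      calc -q₀ ≤ |q₀| * 1 := by rw [mul_one]; exact neg_le_abs _
        _ ≤ |q₀| * t ^ 2 := by gcongr; linarith
    have h3 : (k + S) * t ^ 2 ≤ k * t ^ 3 := by
      calc (k + S) * t ^ 2 = k * t ^ 2 * R := by rw [← hkR]; ring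
        _ ≤ k * t ^ 2 * t := by gcongr
        _ = k * t ^ 3 := by ring
    have h4 : η * (1 + t + t ^ 2) ≤ 1 * (1 + t + t ^ 2) := by gcongr
    have h5 : 0 < k * t ^ 2 := by positivity
    rw [hS] at h3
    nlinarith

/-! ### The frequency condition as a polynomial inequality -/

/-- The real part of `W̃` on the imaginary axis, with the denominators cleared. -/
theorem frequency_polynomial_pos (p : Params) (kf : ℝ)
    (hn : 0 < p.n) (hω₀ : 0 < p.ω₀) (hc : 0 < p.c)
    (hfreq : ∀ ω : ℝ, 0 < (Wtilde p (Complex.I * (ω : ℂ))).re + 1 / kf) (ω : ℝ) :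
    0 < 1 / kf * ((p.c * p.ω₀ ^ 2 - (p.c + 2 * p.n) * ω ^ 2) ^ 2 +
          ω ^ 2 * (p.ω₀ ^ 2 + 2 * p.n * p.c - ω ^ 2) ^ 2) +
        (-p.kd * ω ^ 2 * (p.c * p.ω₀ ^ 2 - (p.c + 2 * p.n) * ω ^ 2) +
          p.kp * ω ^ 2 * (p.ω₀ ^ 2 + 2 * p.n * p.c - ω ^ 2)) := by
  have hpos : 0 < (p.c * p.ω₀ ^ 2 - (p.c + 2 * p.n) * ω ^ 2) ^ 2 +
      ω ^ 2 * (p.ω₀ ^ 2 + 2 * p.n * p.c - ω ^ 2) ^ 2 := by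
    have : (p.c * p.ω₀ ^ 2 - (p.c + 2 * p.n) * ω ^ 2) ^ 2 +
        ω ^ 2 * (p.ω₀ ^ 2 + 2 * p.n * p.c - ω ^ 2) ^ 2 =
        (ω ^ 2 + p.c ^ 2) * ((p.ω₀ ^ 2 - ω ^ 2) ^ 2 + (2 * p.n * ω) ^ 2) := by ring
    rw [this]
    have h2 : 0 < (p.ω₀ ^ 2 - ω ^ 2) ^ 2 + (2 * p.n * ω) ^ 2 := by
      rcases eq_or_ne ω 0 with rfl | hω
      · simp; positivity
      · positivity
    positivity
  have hre : (Wtilde p (Complex.I * (ω : ℂ))).re =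
      (-p.kd * ω ^ 2 * (p.c * p.ω₀ ^ 2 - (p.c + 2 * p.n) * ω ^ 2) +
          p.kp * ω ^ 2 * (p.ω₀ ^ 2 + 2 * p.n * p.c - ω ^ 2)) /
      ((p.c * p.ω₀ ^ 2 - (p.c + 2 * p.n) * ω ^ 2) ^ 2 +
          ω ^ 2 * (p.ω₀ ^ 2 + 2 * p.n * p.c - ω ^ 2) ^ 2) := by
    have hnum : Complex.I * (ω : ℂ) * ((p.kd : ℂ) * (Complex.I * (ω : ℂ)) + (p.kp : ℂ)) =
        ⟨-p.kd * ω ^ 2, p.kp * ω⟩ := by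
      apply Complex.ext <;> simp <;> ring
    have hden : (Complex.I * (ω : ℂ) + (p.c : ℂ)) * ((Complex.I * (ω : ℂ)) ^ 2 +
        2 * (p.n : ℂ) * (Complex.I * (ω : ℂ)) + (p.ω₀ : ℂ) ^ 2) =
        ⟨p.c * p.ω₀ ^ 2 - (p.c + 2 * p.n) * ω ^ 2,
          ω * (p.ω₀ ^ 2 + 2 * p.n * p.c - ω ^ 2)⟩ := by
      apply Complex.ext <;> simp [pow_two] <;> ring
    rw [Wtilde, hnum, hden, Complex.div_re, Complex.normSq_mk, ← add_div]
    congr 1 <;> ring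
  have h := mul_pos hpos (hfreq ω)
  rw [hre, mul_add, mul_div_cancel₀ _ hpos.ne'] at h
  linarith

/-! ### The circle criterion: solving the matrix inequality -/

/-- The fin rate `δ'` as a function of the state `(θ, θ', δ)`. -/
def finRate (p : Params) (x : Fin 3 → ℝ) : ℝ :=
  -p.c * x 2 - p.kp * x 0 - p.kd * x 1

/-- The vector field of the linear part, driven by the input `u`. -/
def linearField (p : Params) (x : Fin 3 → ℝ) (u : ℝ) : Fin 3 → ℝ :=
  ![x 1, u - 2 * p.n * x 1 - p.ω₀ ^ 2 * x 0, finRate p x]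

/-- The linear matrix inequality of the circle criterion for the sector `[0, 1 / k]`. -/
def IsStorage (p : Params) (k : ℝ) (P : Matrix (Fin 3) (Fin 3) ℝ) (ε : ℝ) : Prop :=
  ∀ (x : Fin 3 → ℝ) (u : ℝ),
    2 * (x ⬝ᵥ P *ᵥ linearField p x u) + u * (finRate p x - k * u) ≤ -ε * (x ⬝ᵥ x)

theorem dotProduct_congr_mulVec {n : Type*} [Fintype n] (T Q : Matrix n n ℝ) (x y : n → ℝ) :
    x ⬝ᵥ (Tᵀ * Q * T) *ᵥ y = (T *ᵥ x) ⬝ᵥ Q *ᵥ (T *ᵥ y) := by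
  rw [← mulVec_mulVec, ← mulVec_mulVec, dotProduct_mulVec, vecMul_transpose]

/-- A storage function in the coordinates of the controllable canonical form. -/
theorem exists_canonical_storage {k d₂ d₁ d₀ kd kp : ℝ} (hk : 0 < k)
    (hq : ∀ t : ℝ, 0 ≤ t → 0 < k * t ^ 3 + (k * (d₂ ^ 2 - 2 * d₁) + kd * d₂ - kp) * t ^ 2 +
      (k * (d₁ ^ 2 - 2 * d₀ * d₂) - kd * d₀ + kp * d₁) * t + k * d₀ ^ 2) :
    ∃ (Q : Matrix (Fin 3) (Fin 3) ℝ) (η : ℝ), Q.IsSymm ∧ 0 < η ∧ ∀ (z : Fin 3 → ℝ) (u : ℝ),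
      2 * (z ⬝ᵥ Q *ᵥ ![z 1, z 2, u - d₂ * z 2 - d₁ * z 1 - d₀ * z 0]) -
        u * (kd * z 2 + kp * z 1 + k * u) ≤ -η * (z ⬝ᵥ z) := by
  obtain ⟨η, hη, hqη⟩ := exists_cubic_margin hk hq
  obtain ⟨g₃, g₂, g₁, g₀, h3, h2, h1, h0⟩ := exists_spectral_factor hk hqη
  -- Comparing coefficients in `2 zᵀ Q z' = u (kd z₂ + kp z₁ + k u) - η |z|² - (g₃ y + g₂ z₂ + g₁ z₁
  -- + g₀ z₀)²`, with `y = z₂'`. The spectral factorization makes the right side an exact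
  -- derivative.
  refine ⟨
    !![k * d₀ * d₁ + kp * d₀ / 2 - g₀ * g₁, k * d₀ * d₂ + kd * d₀ / 2 - g₀ * g₂, k * d₀ - g₃ * g₀;
       k * d₀ * d₂ + kd * d₀ / 2 - g₀ * g₂,
        k * d₁ * d₂ + kd * d₁ / 2 + kp * d₂ / 2 - g₁ * g₂ - k * d₀ + g₃ * g₀,
        k * d₁ + kp / 2 - g₃ * g₁;
       k * d₀ - g₃ * g₀, k * d₁ + kp / 2 - g₃ * g₁, k * d₂ + kd / 2 - g₃ * g₂], η, ?_, hη, ?_⟩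
  · ext i j; fin_cases i <;> fin_cases j <;> rfl
  · intro z u
    obtain ⟨y, hy⟩ : ∃ y, y = u - d₂ * z 2 - d₁ * z 1 - d₀ * z 0 := ⟨_, rfl⟩
    have hu : u = y + d₂ * z 2 + d₁ * z 1 + d₀ * z 0 := by rw [hy]; ring
    rw [← hy, hu]
    have hsq := sq_nonneg (g₃ * y + g₂ * z 2 + g₁ * z 1 + g₀ * z 0)
    simp [Matrix.mulVec, dotProduct, Fin.sum_univ_three]
    linear_combination hsq + y ^ 2 * h3 + z 2 ^ 2 * h2 + z 1 ^ 2 * h1 + z 0 ^ 2 * h0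

/-- The circle criterion when the linear part is controllable. -/
theorem exists_storage_of_ne {p : Params} {k : ℝ} (hk : 0 < k) (hne : p.kp ≠ p.c * p.kd)
    (hfreq : ∀ ω : ℝ,
      0 < k * ((p.c * p.ω₀ ^ 2 - (p.c + 2 * p.n) * ω ^ 2) ^ 2 +
          ω ^ 2 * (p.ω₀ ^ 2 + 2 * p.n * p.c - ω ^ 2) ^ 2) +
        (-p.kd * ω ^ 2 * (p.c * p.ω₀ ^ 2 - (p.c + 2 * p.n) * ω ^ 2) +
          p.kp * ω ^ 2 * (p.ω₀ ^ 2 + 2 * p.n * p.c - ω ^ 2))) :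
    ∃ (P : Matrix (Fin 3) (Fin 3) ℝ) (ε : ℝ), P.IsSymm ∧ 0 < ε ∧ IsStorage p k P ε := by
  obtain ⟨n, w, c, kp, kd⟩ := p
  simp only at hne hfreq
  obtain ⟨Q, η, hQ, hη, hQη⟩ := exists_canonical_storage (d₂ := c + 2 * n)
    (d₁ := w ^ 2 + 2 * n * c) (d₀ := c * w ^ 2) (kd := kd) (kp := kp) hk (by
      intro t ht
      have h := hfreq √t
      rw [Real.sq_sqrt ht] at h
      linarith)
  obtain ⟨κ, hκ⟩ : ∃ κ, κ = (c * kd - kp)⁻¹ := ⟨_, rfl⟩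
  have hκ1 : κ * (c * kd - kp) = 1 := by
    rw [hκ]; exact inv_mul_cancel₀ (sub_ne_zero.2 hne.symm)
  obtain ⟨C, hC⟩ : ∃ C, C = 4 + 4 * c ^ 2 + kd ^ 2 + kp ^ 2 := ⟨_, rfl⟩
  have hC0 : 0 < C := by rw [hC]; positivity
  -- Phase variables: `z₀ = κ (δ + kd θ)` satisfies `z₀' + c z₀ = θ`, so `z₁ = z₀'` and `z₂ = z₀''`
  -- are linear in the state.
  set T : Matrix (Fin 3) (Fin 3) ℝ :=
    !![κ * kd, 0, κ; 1 - c * κ * kd, 0, -c * κ;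
      -c + c ^ 2 * κ * kd, 1, c ^ 2 * κ] with hT
  refine ⟨Tᵀ * Q * T, η / C, ?_, by positivity, ?_⟩
  · simp [Matrix.IsSymm, Matrix.transpose_mul, hQ.eq, Matrix.mul_assoc]
  · intro x u
    obtain ⟨z, hz⟩ : ∃ z, z = T *ᵥ x := ⟨_, rfl⟩
    have hz0 : z 0 = κ * (x 2 + kd * x 0) := by
      rw [hz, hT]; simp [Matrix.mulVec, dotProduct, Fin.sum_univ_three]; ring
    have hz1 : z 1 = x 0 - c * z 0 := by
      rw [hz0, hz, hT]; simp [Matrix.mulVec, dotProduct, Fin.sum_univ_three]; ring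
    have hz2 : z 2 = x 1 - c * z 1 := by
      rw [hz1, hz0, hz, hT]; simp [Matrix.mulVec, dotProduct, Fin.sum_univ_three]; ring
    have hx0 : x 0 = z 1 + c * z 0 := by rw [hz1]; ring
    have hx1 : x 1 = z 2 + c * z 1 := by rw [hz2]; ring
    have hx2 : x 2 = -(kd * z 1 + kp * z 0) := by
      rw [hz1]; linear_combination (-(x 2 + kd * x 0)) * hκ1 + (c * kd - kp) * (-hz0)
    have hfield : T *ᵥ linearField ⟨n, w, c, kp, kd⟩ x u =
        ![z 1, z 2, u - (c + 2 * n) * z 2 - (w ^ 2 + 2 * n * c) * z 1 - c * w ^ 2 * z 0] := by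
      rw [hT]
      ext i
      fin_cases i <;>
        simp [linearField, finRate, Matrix.mulVec, dotProduct, Fin.sum_univ_three, hx0, hx1, hx2]
      · linear_combination z 1 * hκ1
      · linear_combination (-c * z 1) * hκ1
      · linear_combination (c ^ 2 * z 1) * hκ1
    have hrate : finRate ⟨n, w, c, kp, kd⟩ x = -(kd * z 2 + kp * z 1) := by
      simp only [finRate, hx0, hx1, hx2]; ring
    have hnorm : x ⬝ᵥ x ≤ C * (z ⬝ᵥ z) := by
      simp only [dotProduct, Fin.sum_univ_three, hx0, hx1, hx2, hC]
      nlinarith [sq_nonneg (z 1 - c * z 0), sq_nonneg (z 2 - c * z 1),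
        sq_nonneg (kp * z 1 - kd * z 0), sq_nonneg (z 0), sq_nonneg (z 1), sq_nonneg (z 2),
        sq_nonneg (c * z 0), sq_nonneg (c * z 1), sq_nonneg (c * z 2), sq_nonneg (kd * z 2),
        sq_nonneg (kp * z 2)]
    rw [dotProduct_congr_mulVec, hfield, ← hz, hrate]
    have h := hQη z u
    have h' : η / C * (x ⬝ᵥ x) ≤ η * (z ⬝ᵥ z) := by
      rw [div_mul_eq_mul_div, div_le_iff₀ hC0]; nlinarith
    linarith

/-- A positive definite binary quadratic form dominates a multiple of the squared norm. -/
theorem exists_quadratic_margin {X k s : ℝ} (hX : 0 < X) (hk : 0 < k) (hs : s ^ 2 < 4 * X * k) :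
    ∃ μ : ℝ, 0 < μ ∧ ∀ b u : ℝ,
      s * b * u ≤ (X - 3 * μ) * b ^ 2 + (k - 3 * μ) * u ^ 2 := by
  -- With this `μ`, `4 (X - 3 μ) (k - 3 μ) - s² = 36 μ²`, so the reduced form stays definite.
  obtain ⟨μ, hμ⟩ : ∃ μ, μ = (4 * X * k - s ^ 2) / (12 * (X + k)) := ⟨_, rfl⟩
  have hμ0 : 0 < μ := by
    rw [hμ]; exact div_pos (sub_pos.2 hs) (by positivity)
  have hμe : μ * (12 * (X + k)) = 4 * X * k - s ^ 2 := by
    rw [hμ]; field_simp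
  have hμX : 0 < X - 3 * μ := by
    have h : 0 < 4 * k * (X - 3 * μ) := by
      have : 4 * k * (X - 3 * μ) = 12 * μ * X + s ^ 2 := by linarith
      rw [this]; positivity
    exact pos_of_mul_pos_right h (by positivity)
  refine ⟨μ, hμ0, fun b u => ?_⟩
  have h : 0 ≤ 4 * (X - 3 * μ) *
      ((X - 3 * μ) * b ^ 2 + (k - 3 * μ) * u ^ 2 - s * b * u) := by
    have : 4 * (X - 3 * μ) *
        ((X - 3 * μ) * b ^ 2 + (k - 3 * μ) * u ^ 2 - s * b * u) =
        (2 * (X - 3 * μ) * b - s * u) ^ 2 + (6 * μ * u) ^ 2 := by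
      linear_combination -u ^ 2 * hμe
    rw [this]; positivity
  exact sub_nonneg.1 (nonneg_of_mul_nonneg_right h (by positivity))

/-- The dissipation inequality behind `exists_storage_of_eq`. -/
theorem dissipation_le {n w c μ q M r : ℝ} (hw : 0 < w) (hμ : 0 < μ)
    (hq : 0 ≤ q) (hq₁ : n * q ≤ μ * w ^ 2 / 4) (hq₂ : q ≤ μ) (hM : 2 * (M * μ) = c)
    (hn : 0 < n) (hr₁ : r ≤ 2 * n * q * w ^ 2) (hr₂ : r ≤ 2 * μ) (hr₃ : r ≤ M * c)
    (a b e u : ℝ) :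
    q * (2 * b * u) + 4 * n * q * (a * u) - c * e * u + r * (a ^ 2 + b ^ 2 + e ^ 2) ≤
      4 * n * q * w ^ 2 * a ^ 2 + 3 * μ * (b ^ 2 + u ^ 2) + 2 * (M * c) * e ^ 2 := by
  have h2 : q * (2 * b * u) ≤ μ * (b ^ 2 + u ^ 2) :=
    calc q * (2 * b * u) ≤ q * (b ^ 2 + u ^ 2) := by
          gcongr; exact two_mul_le_add_sq b u
      _ ≤ μ * (b ^ 2 + u ^ 2) := by gcongr
  have h3 : 4 * n * q * (a * u) ≤ 2 * n * q * w ^ 2 * a ^ 2 + μ / 2 * u ^ 2 := by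
    refine le_of_mul_le_mul_left ?_ (show 0 < w ^ 2 by positivity)
    have e1 : 0 ≤ 2 * (n * q) * (w ^ 2 * a - u) ^ 2 := by positivity
    have e2 : 2 * (n * q) * u ^ 2 ≤ 2 * (μ * w ^ 2 / 4) * u ^ 2 := by gcongr
    linarith
  -- `2 M μ = c` makes the defect a perfect square and costs only half of the dissipation `2 M c
  -- e²`.
  have h4 : -c * e * u ≤ μ / 2 * u ^ 2 + M * c * e ^ 2 := by
    have : μ / 2 * u ^ 2 + M * c * e ^ 2 + c * e * u = μ / 2 * (u + 2 * M * e) ^ 2 := by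
      rw [← hM]; ring
    have h5 : 0 ≤ μ / 2 * (u + 2 * M * e) ^ 2 := by positivity
    linarith
  have ha := mul_le_mul_of_nonneg_right hr₁ (sq_nonneg a)
  have hb := mul_le_mul_of_nonneg_right hr₂ (sq_nonneg b)
  have he := mul_le_mul_of_nonneg_right hr₃ (sq_nonneg e)
  have h6 : 0 ≤ μ * u ^ 2 := by positivity
  linarith

/-- The circle criterion when `s + c` cancels in `W̃`. -/
theorem exists_storage_of_eq {p : Params} {k : ℝ} (hn : 0 < p.n) (hω₀ : 0 < p.ω₀) (hc : 0 < p.c)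
    (hk : 0 < k) (heq : p.kp = p.c * p.kd) (hkd : 0 < p.kd + 2 * p.n * k) :
    ∃ (P : Matrix (Fin 3) (Fin 3) ℝ) (ε : ℝ), P.IsSymm ∧ 0 < ε ∧ IsStorage p k P ε := by
  obtain ⟨n, w, c, kp, kd⟩ := p
  simp only at hn hω₀ hc heq hkd
  subst heq
  have hnk : 0 < n * k := mul_pos hn hk
  -- This `l` maximizes the gap `16 n l k - (2 l - kd)²`.
  obtain ⟨l, hl⟩ : ∃ l, l = 2 * (n * k) + kd / 2 := ⟨_, rfl⟩
  have hl0 : 0 < l := by rw [hl]; linarith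
  have hgap : (2 * l - kd) ^ 2 < 4 * (4 * n * l) * k := by
    have : 4 * (4 * n * l) * k - (2 * l - kd) ^ 2 = 8 * (n * k) * (kd + 2 * n * k) := by
      rw [hl]; ring
    have h : 0 < 8 * (n * k) * (kd + 2 * n * k) := by positivity
    linarith
  obtain ⟨μ, hμ0, hbu⟩ := exists_quadratic_margin (by positivity) hk hgap
  obtain ⟨q, hq0, hq2, hq1⟩ : ∃ q : ℝ, 0 < q ∧ q ≤ μ ∧ n * q ≤ μ * w ^ 2 / 4 := by
    refine ⟨min μ (μ * w ^ 2 / 4 / n), by positivity, min_le_left _ _, ?_⟩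
    rw [mul_comm, ← le_div_iff₀ hn]
    exact min_le_right _ _
  obtain ⟨M, hM⟩ : ∃ M, M = c / (2 * μ) := ⟨_, rfl⟩
  have hM0 : 0 < M := by rw [hM]; positivity
  have hMe : 2 * (M * μ) = c := by rw [hM]; field_simp
  obtain ⟨r, hr0, hr1, hr2, hr3⟩ : ∃ r : ℝ, 0 < r ∧ r ≤ 2 * n * q * w ^ 2 ∧ r ≤ 2 * μ ∧
      r ≤ M * c :=
    ⟨min (2 * n * q * w ^ 2) (min (2 * μ) (M * c)), by positivity, min_le_left _ _,
      (min_le_right _ _).trans (min_le_left _ _), (min_le_right _ _).trans (min_le_right _ _)⟩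
  -- The form is `l (w² a² + b²) + q ((b + 2 n a)² + w² a²) + M e²`, where `a = θ`, `b = θ'` and `e
  -- = δ + kd θ` is the uncontrollable mode, `e' = -c e`. The energy alone does not dissipate `a²`;
  -- the `q` term does.
  refine ⟨!![l * w ^ 2 + q * (4 * n ^ 2 + w ^ 2) + M * kd ^ 2, 2 * n * q, M * kd;
      2 * n * q, l + q, 0; M * kd, 0, M], r / (2 + 2 * kd ^ 2), ?_, by positivity, ?_⟩
  · ext i j; fin_cases i <;> fin_cases j <;> rfl
  · intro x u
    obtain ⟨e, he⟩ : ∃ e, e = x 2 + kd * x 0 := ⟨_, rfl⟩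
    have hx2 : x 2 = e - kd * x 0 := by rw [he]; ring
    obtain ⟨a, ha⟩ : ∃ a, a = x 0 := ⟨_, rfl⟩
    obtain ⟨b, hb⟩ : ∃ b, b = x 1 := ⟨_, rfl⟩
    have hnorm : r / (2 + 2 * kd ^ 2) * (x ⬝ᵥ x) ≤ r * (a ^ 2 + b ^ 2 + e ^ 2) := by
      rw [div_mul_eq_mul_div, div_le_iff₀ (by positivity), mul_assoc]
      gcongr
      simp only [dotProduct, Fin.sum_univ_three, hx2, ← ha, ← hb]
      nlinarith [sq_nonneg (e + kd * a), sq_nonneg (kd * b), sq_nonneg (kd * e), sq_nonneg a,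
        sq_nonneg b]
    have h1 := hbu b u
    have h2 := dissipation_le hω₀ hμ0 hq0.le hq1 hq2 hMe hn hr1 hr2 hr3 a b e u
    refine le_trans ?_ (show -(r * (a ^ 2 + b ^ 2 + e ^ 2)) ≤ _ by linarith)
    simp [linearField, finRate, Matrix.mulVec, dotProduct, Fin.sum_univ_three, hx2, ← ha, ← hb]
    linarith

/-- The circle criterion for the linear part of the roll dynamics. -/
theorem exists_storage {p : Params} {kf : ℝ} (hn : 0 < p.n) (hω₀ : 0 < p.ω₀) (hc : 0 < p.c)
    (hkf : 0 < kf)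
    (hfreq : ∀ ω : ℝ, 0 < (Wtilde p (Complex.I * (ω : ℂ))).re + 1 / kf) :
    ∃ (P : Matrix (Fin 3) (Fin 3) ℝ) (ε : ℝ), P.IsSymm ∧ 0 < ε ∧ IsStorage p (1 / kf) P ε := by
  have hk : 0 < 1 / kf := by positivity
  have h := frequency_polynomial_pos p kf hn hω₀ hc hfreq
  rcases eq_or_ne p.kp (p.c * p.kd) with heq | hne
  · refine exists_storage_of_eq hn hω₀ hc hk heq ?_
    -- At resonance the reduced transfer function takes the real value `kd / (2 n)`.
    have h1 := h p.ω₀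
    have h2 : 0 < (2 * p.n * p.ω₀ ^ 2 * (p.ω₀ ^ 2 + p.c ^ 2)) *
        (p.kd + 2 * p.n * (1 / kf)) := by
      rw [heq] at h1
      linarith
    exact pos_of_mul_pos_right h2 (by positivity)
  · exact exists_storage_of_ne hk hne h

/-! ### Positive definiteness of the storage matrix -/

/-- A Lyapunov matrix for the linear part without input. -/
theorem exists_lyapunov {p : Params} (hn : 0 < p.n) (hω₀ : 0 < p.ω₀) (hc : 0 < p.c) :
    ∃ P : Matrix (Fin 3) (Fin 3) ℝ, P.PosDef ∧
      ∀ x : Fin 3 → ℝ, x ≠ 0 → x ⬝ᵥ P *ᵥ linearField p x 0 < 0 := by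
  obtain ⟨n, w, c, kp, kd⟩ := p
  simp only at hn hω₀ hc
  obtain ⟨κ, hκ⟩ : ∃ κ, κ = c * kd - kp := ⟨_, rfl⟩
  -- Since `e = δ + kd θ` obeys `e' = -c e + κ θ`, the oscillator term must dissipate `θ²` and also
  -- the `κ² / c θ²` that absorbs the cross term with `e`.
  obtain ⟨N, hN⟩ : ∃ N, N = (1 + κ ^ 2 / c) / (4 * n * w ^ 2) := ⟨_, rfl⟩
  have hN0 : 0 < N := by rw [hN]; positivity
  have hNe : N * (4 * n * w ^ 2) = 1 + κ ^ 2 / c := by rw [hN]; field_simp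
  have hpos : ∀ x : Fin 3 → ℝ, x ≠ 0 → ∀ r s t : ℝ, 0 < r → 0 < s → 0 < t →
      0 < r * x 0 ^ 2 + s * x 1 ^ 2 + t * (x 2 + kd * x 0) ^ 2 := by
    intro x hx r s t hr hs ht
    rcases eq_or_ne (x 0) 0 with h0 | h0
    · rcases eq_or_ne (x 1) 0 with h1 | h1
      · have h2 : x 2 ≠ 0 := by
          intro h2
          apply hx
          ext i
          fin_cases i <;> simp [h0, h1, h2]
        simp only [h0, h1]
        simp
        positivity
      · positivity
    · positivity
  refine ⟨!![N * (4 * n ^ 2 + 2 * w ^ 2) + kd ^ 2, N * (2 * n), kd; N * (2 * n), N * 2, 0;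
      kd, 0, 1], Matrix.PosDef.of_dotProduct_mulVec_pos ?_ ?_, ?_⟩
  · ext i j; fin_cases i <;> fin_cases j <;> simp
  · intro x hx
    refine lt_of_lt_of_le (hpos x hx (N * (2 * w ^ 2)) N 1 (by positivity) hN0 one_pos) ?_
    have h : 0 ≤ N * (x 1 + 2 * n * x 0) ^ 2 := by positivity
    simp [Matrix.mulVec, dotProduct, Fin.sum_univ_three]
    linarith
  · intro x hx
    have h1 := hpos x hx 1 (4 * n * N) c one_pos (by positivity) hc
    have h2 : 0 ≤ c * (x 2 + kd * x 0) ^ 2 - 2 * κ * x 0 * (x 2 + kd * x 0) +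
        κ ^ 2 / c * x 0 ^ 2 := by
      have : c * (x 2 + kd * x 0) ^ 2 - 2 * κ * x 0 * (x 2 + kd * x 0) + κ ^ 2 / c * x 0 ^ 2 =
          c * ((x 2 + kd * x 0) - κ / c * x 0) ^ 2 := by field_simp; ring
      rw [this]; positivity
    have h3 : κ ^ 2 / c * x 0 ^ 2 = N * (4 * n * w ^ 2) * x 0 ^ 2 - x 0 ^ 2 := by
      rw [hNe]; ring
    rw [h3, hκ] at h2
    simp [linearField, finRate, Matrix.mulVec, dotProduct, Fin.sum_univ_three]
    linarith

/-- If the quadratic forms of `P` and of a positive definite `P₀` both decrease along the same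
field, then `P` is positive definite. -/
theorem posDef_of_common_decrease {n : Type*} [Fintype n] {P P₀ : Matrix n n ℝ}
    (hP : P.IsSymm) (hP₀ : P₀.PosDef) (f : (n → ℝ) → n → ℝ)
    (hf : ∀ x, x ≠ 0 → x ⬝ᵥ P *ᵥ f x < 0) (hf₀ : ∀ x, x ≠ 0 → x ⬝ᵥ P₀ *ᵥ f x < 0) :
    P.PosDef := by
  have hPH : P.IsHermitian := by rw [Matrix.IsHermitian, conjTranspose_eq_transpose_of_trivial, hP]
  have hpos₀ : ∀ x, x ≠ 0 → 0 < x ⬝ᵥ P₀ *ᵥ x := fun x hx => by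
    simpa using hP₀.dotProduct_mulVec_pos hx
  rcases isEmpty_or_nonempty n with hn | hn
  · exact Matrix.PosDef.of_dotProduct_mulVec_pos hPH fun x hx => (hx (Subsingleton.elim _ _)).elim
  have hne : (Metric.sphere (0 : n → ℝ) 1).Nonempty := NormedSpace.sphere_nonempty.2 zero_le_one
  have hne0 : ∀ x ∈ Metric.sphere (0 : n → ℝ) 1, x ≠ 0 := fun x hx =>
    ne_zero_of_mem_unit_sphere ⟨x, hx⟩
  have hcont : ContinuousOn (fun x : n → ℝ => (x ⬝ᵥ P *ᵥ x) / (x ⬝ᵥ P₀ *ᵥ x))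
      (Metric.sphere 0 1) := by
    refine ContinuousOn.div ?_ ?_ fun x hx => (hpos₀ x (hne0 x hx)).ne' <;>
    · apply Continuous.continuousOn
      fun_prop
  obtain ⟨z, hz, hmin⟩ := (isCompact_sphere (0 : n → ℝ) 1).exists_isMinOn hne hcont
  have hz0 := hne0 z hz
  obtain ⟨l, hl⟩ : ∃ l, l = (z ⬝ᵥ P *ᵥ z) / (z ⬝ᵥ P₀ *ᵥ z) := ⟨_, rfl⟩
  have hle : ∀ x, x ≠ 0 → l * (x ⬝ᵥ P₀ *ᵥ x) ≤ x ⬝ᵥ P *ᵥ x := by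
    intro x hx
    have hxn : ‖x‖ ≠ 0 := norm_ne_zero_iff.2 hx
    have h : (‖x‖⁻¹ • x) ∈ Metric.sphere (0 : n → ℝ) 1 := by
      simp [norm_smul, hxn]
    have h1 := hmin h
    simp only [Set.mem_ofPred_eq, ← hl, mulVec_smul, dotProduct_smul, smul_dotProduct,
      smul_eq_mul] at h1
    rw [mul_div_mul_left _ _ (inv_ne_zero hxn), mul_div_mul_left _ _ (inv_ne_zero hxn),
      le_div_iff₀ (hpos₀ x hx)] at h1
    exact h1
  have hQ : (P - l • P₀).PosSemidef := by
    refine Matrix.PosSemidef.of_dotProduct_mulVec_nonneg ?_ fun x => ?_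
    · refine hPH.sub ?_
      rw [Matrix.IsHermitian, conjTranspose_smul, hP₀.1.eq]; simp
    · rcases eq_or_ne x 0 with rfl | hx
      · simp
      · have := hle x hx
        simp only [star_trivial, sub_mulVec, smul_mulVec, dotProduct_sub, dotProduct_smul,
          smul_eq_mul]
        linarith
  -- `z` minimizes the ratio of the two forms, so the semidefinite `P - l P₀` vanishes at `z` and
  -- has `z` in its kernel. Pairing with `f z` exhibits `l` as a quotient of two negative numbers.
  have hQz : (P - l • P₀) *ᵥ z = 0 := by
    classical
    rw [← hQ.dotProduct_mulVec_zero_iff z]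
    simp only [star_trivial, sub_mulVec, smul_mulVec, dotProduct_sub, dotProduct_smul,
      smul_eq_mul, hl]
    rw [div_mul_cancel₀ _ (hpos₀ z hz0).ne', sub_self]
  have hQf : z ⬝ᵥ (P - l • P₀) *ᵥ f z = 0 := by
    have hs : (P - l • P₀)ᵀ = P - l • P₀ := by
      simpa [Matrix.IsHermitian] using hQ.1
    rw [dotProduct_mulVec, ← mulVec_transpose, hs, hQz, zero_dotProduct]
  simp only [sub_mulVec, smul_mulVec, dotProduct_sub, dotProduct_smul, smul_eq_mul] at hQf
  have hl0 : 0 < l := by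
    have h1 := hf z hz0
    have h2 := hf₀ z hz0
    by_contra! hcon
    nlinarith
  refine Matrix.PosDef.of_dotProduct_mulVec_pos hPH fun x hx => ?_
  rw [star_trivial]
  exact lt_of_lt_of_le (mul_pos hl0 (hpos₀ x hx)) (hle x hx)

/-- A storage matrix is positive definite, as the linear part is stable. -/
theorem IsStorage.posDef {p : Params} {k ε : ℝ} {P : Matrix (Fin 3) (Fin 3) ℝ}
    (hn : 0 < p.n) (hω₀ : 0 < p.ω₀) (hc : 0 < p.c) (hP : P.IsSymm) (hε : 0 < ε)
    (h : IsStorage p k P ε) : P.PosDef := by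
  obtain ⟨P₀, hP₀, hf₀⟩ := exists_lyapunov (p := p) hn hω₀ hc
  refine posDef_of_common_decrease hP hP₀ (fun x => linearField p x 0) (fun x hx => ?_) hf₀
  have h1 := h x 0
  have h2 : 0 < x ⬝ᵥ x := by simpa using (dotProduct_star_self_pos_iff (v := x)).2 hx
  nlinarith [mul_pos hε h2]

/-! ### From the matrix inequality to incremental stability -/

/-- The quadratic form of a positive definite matrix is comparable to the squared norm. -/
theorem exists_quadForm_bounds {P : Matrix (Fin 3) (Fin 3) ℝ} (hP : P.PosDef) :
    ∃ l L : ℝ, 0 < l ∧ 0 < L ∧ ∀ z : EuclideanSpace ℝ (Fin 3),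
      l * ‖z‖ ^ 2 ≤ quadForm P z ∧ quadForm P z ≤ L * ‖z‖ ^ 2 := by
  have hne : (Metric.sphere (0 : EuclideanSpace ℝ (Fin 3)) 1).Nonempty :=
    NormedSpace.sphere_nonempty.2 zero_le_one
  have hcont : ContinuousOn (quadForm P) (Metric.sphere 0 1) := by
    apply Continuous.continuousOn
    unfold quadForm
    fun_prop
  have hpos : ∀ z ∈ Metric.sphere (0 : EuclideanSpace ℝ (Fin 3)) 1, 0 < quadForm P z := by
    intro z hz
    have h : z.ofLp ≠ 0 := fun h => ne_zero_of_mem_unit_sphere ⟨z, hz⟩ (by ext i; simp [h])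
    simpa [quadForm] using hP.dotProduct_mulVec_pos h
  obtain ⟨x, hx, hmin⟩ := (isCompact_sphere _ _).exists_isMinOn hne hcont
  obtain ⟨y, hy, hmax⟩ := (isCompact_sphere _ _).exists_isMaxOn hne hcont
  refine ⟨quadForm P x, quadForm P y, hpos x hx, hpos y hy, fun z => ?_⟩
  rcases eq_or_ne z 0 with rfl | hz
  · simp [quadForm]
  have hzn : 0 < ‖z‖ := norm_pos_iff.2 hz
  have hmem : (‖z‖⁻¹ • z) ∈ Metric.sphere (0 : EuclideanSpace ℝ (Fin 3)) 1 := by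
    simp [norm_smul, hzn.ne']
  have hscale : quadForm P z = quadForm P (‖z‖⁻¹ • z) * ‖z‖ ^ 2 := by
    simp only [quadForm, WithLp.ofLp_smul, mulVec_smul, dotProduct_smul, smul_dotProduct,
      smul_eq_mul]
    field_simp
  rw [hscale]
  constructor <;> gcongr
  · exact hmin hmem
  · exact hmax hmem

/-- The increment of a slope restricted function satisfies the sector condition. -/
theorem SlopeRestricted.sector {kf : ℝ} {h : ℝ → ℝ} (hh : SlopeRestricted kf h) (hkf : 0 < kf)
    (a b : ℝ) : 0 ≤ (h a - h b) * ((a - b) - 1 / kf * (h a - h b)) := by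
  rcases eq_or_ne a b with rfl | hab
  · simp
  obtain ⟨h0, h1⟩ := hh a b hab
  obtain ⟨q, hq⟩ : ∃ q, q = (h a - h b) / (a - b) := ⟨_, rfl⟩
  have e : h a - h b = q * (a - b) := by
    rw [hq, div_mul_cancel₀ _ (sub_ne_zero.2 hab)]
  rw [← hq] at h0 h1
  have h2 : 0 ≤ 1 - 1 / kf * q := by
    rw [one_div, ← div_eq_inv_mul, sub_nonneg, div_le_one hkf]; exact h1
  have h3 : (h a - h b) * ((a - b) - 1 / kf * (h a - h b)) =
      q * (1 - 1 / kf * q) * (a - b) ^ 2 := by rw [e]; ring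
  rw [h3]
  positivity

/-- The derivative of a symmetric quadratic form along a curve. -/
theorem hasDerivWithinAt_quadForm {P : Matrix (Fin 3) (Fin 3) ℝ} (hP : P.IsSymm)
    {z : ℝ → EuclideanSpace ℝ (Fin 3)} {z' : Fin 3 → ℝ} {I : Set ℝ} {t : ℝ}
    (hz : ∀ i, HasDerivWithinAt (fun τ => z τ i) (z' i) I t) :
    HasDerivWithinAt (fun τ => quadForm P (z τ)) (2 * ((z t).ofLp ⬝ᵥ P *ᵥ z')) I t := by
  have h : HasDerivWithinAt (fun τ => ∑ i, ∑ j, P i j * (z τ i * z τ j))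
      (∑ i, ∑ j, P i j * (z' i * z t j + z t i * z' j)) I t :=
    HasDerivWithinAt.fun_sum fun i _ => HasDerivWithinAt.fun_sum fun j _ =>
      ((hz i).mul (hz j)).const_mul _
  convert h using 1
  · ext τ
    simp only [quadForm, dotProduct, mulVec, Finset.mul_sum]
    exact Finset.sum_congr rfl fun i _ => Finset.sum_congr rfl fun j _ => by ring
  · have h10 : P 1 0 = P 0 1 := hP.apply 0 1
    have h20 : P 2 0 = P 0 2 := hP.apply 0 2
    have h21 : P 2 1 = P 1 2 := hP.apply 1 2
    simp only [dotProduct, mulVec, Fin.sum_univ_three, h10, h20, h21]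
    ring

/-- The storage function decreases along the difference of two trajectories. -/
theorem IsStorage.isIncrementalLyapunov {p : Params} {kf ε L : ℝ}
    {P : Matrix (Fin 3) (Fin 3) ℝ} (hS : IsStorage p (1 / kf) P ε) (hP : P.IsSymm)
    (hkf : 0 < kf) (hε : 0 < ε) (hL : 0 < L)
    (hPL : ∀ z : EuclideanSpace ℝ (Fin 3), quadForm P z ≤ L * ‖z‖ ^ 2)
    {h : ℝ → ℝ} (hh : SlopeRestricted kf h) : IsIncrementalLyapunov p h P (ε / L) := by
  rintro m I - x x' ⟨θ, θ₁, θ₂, δ, δ₁, hs, hx⟩ ⟨φ, φ₁, φ₂, γ, γ₁, hs', hx'⟩ t ht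
  obtain ⟨z, hz⟩ : ∃ z : ℝ → EuclideanSpace ℝ (Fin 3),
    z = fun τ => !₂[θ τ - φ τ, θ₁ τ - φ₁ τ, δ τ - γ τ] := ⟨_, rfl⟩
  have hxz : ∀ τ ∈ I, x τ - x' τ = z τ := by
    intro τ hτ
    rw [hx τ hτ, hx' τ hτ, hz]
    ext i
    fin_cases i <;> simp
  obtain ⟨u, hu⟩ : ∃ u, u = h (δ₁ t) - h (γ₁ t) := ⟨_, rfl⟩
  have hrate : finRate p (z t).ofLp = δ₁ t - γ₁ t := by
    have e1 := hs.fin_eq t ht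
    have e2 := hs'.fin_eq t ht
    simp [hz, finRate]
    linarith
  have hder : ∀ i, HasDerivWithinAt (fun τ => z τ i) (linearField p (z t).ofLp u i) I t := by
    intro i
    fin_cases i
    · simpa [hz, linearField] using (hs.roll_rate t ht).fun_sub (hs'.roll_rate t ht)
    · have e1 := hs.roll_eq t ht
      have e2 := hs'.roll_eq t ht
      have e : linearField p (z t).ofLp u 1 = θ₂ t - φ₂ t := by
        simp [hz, linearField, hu]
        linarith
      change HasDerivWithinAt (fun τ => z τ 1) (linearField p (z t).ofLp u 1) I t
      rw [e]
      simpa [hz] using (hs.roll_acc t ht).fun_sub (hs'.roll_acc t ht)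
    · have e : linearField p (z t).ofLp u 2 = δ₁ t - γ₁ t := hrate
      change HasDerivWithinAt (fun τ => z τ 2) (linearField p (z t).ofLp u 2) I t
      rw [e]
      simpa [hz] using (hs.fin_rate t ht).fun_sub (hs'.fin_rate t ht)
  refine ⟨_, (hasDerivWithinAt_quadForm hP hder).congr (fun τ hτ => by rw [hxz τ hτ])
    (by rw [hxz t ht]), ?_⟩
  rw [hxz t ht]
  have h1 := hS (z t).ofLp u
  have h2 := hh.sector hkf (δ₁ t) (γ₁ t)
  rw [← hu, ← hrate] at h2
  have h3 : (z t).ofLp ⬝ᵥ (z t).ofLp = ‖z t‖ ^ 2 := by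
    rw [EuclideanSpace.real_norm_sq_eq]
    simp [dotProduct, pow_two]
  have h4 : ε / L * quadForm P (z t) ≤ ε * ‖z t‖ ^ 2 :=
    calc ε / L * quadForm P (z t) ≤ ε / L * (L * ‖z t‖ ^ 2) := by gcongr; exact hPL _
      _ = ε * ‖z t‖ ^ 2 := by field_simp
  rw [h3] at h1
  linarith

/-- A differential inequality `v' ≤ -ε v` yields exponential decay. -/
theorem le_exp_mul_of_deriv_le {v : ℝ → ℝ} {I : Set ℝ} (hI : I.OrdConnected) {ε : ℝ}
    (hv : ∀ t ∈ I, ∃ D, HasDerivWithinAt v D I t ∧ D ≤ -ε * v t) {s t : ℝ}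
    (hs : s ∈ I) (ht : t ∈ I) (hst : s ≤ t) : v t ≤ Real.exp (-ε * (t - s)) * v s := by
  choose! D hD hDle using hv
  have hexp : ∀ τ, HasDerivAt (fun τ => Real.exp (ε * τ)) (Real.exp (ε * τ) * ε) τ := fun τ => by
    simpa using ((hasDerivAt_id τ).const_mul ε).exp
  have hprod : ∀ τ ∈ I, HasDerivWithinAt (fun τ => Real.exp (ε * τ) * v τ)
      (Real.exp (ε * τ) * ε * v τ + Real.exp (ε * τ) * D τ) I τ := fun τ hτ =>
    (hexp τ).hasDerivWithinAt.mul (hD τ hτ)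
  -- The integrating factor `exp (ε τ)` turns the differential inequality into monotonicity.
  have hanti : AntitoneOn (fun τ => Real.exp (ε * τ) * v τ) I := by
    refine antitoneOn_of_hasDerivWithinAt_nonpos hI.convex
      (fun τ hτ => (hprod τ hτ).continuousWithinAt)
      (fun τ hτ => (hprod τ (interior_subset hτ)).mono interior_subset) fun τ hτ => ?_
    have h := mul_le_mul_of_nonneg_left (hDle τ (interior_subset hτ)) (Real.exp_pos (ε * τ)).le
    linarith
  have h := hanti hs ht hst
  simp only at h
  have e : Real.exp (-ε * (t - s)) = Real.exp (ε * s) / Real.exp (ε * t) := by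
    rw [← Real.exp_sub]; ring_nf
  rw [e, div_mul_eq_mul_div, le_div_iff₀ (Real.exp_pos _), mul_comm]
  exact h

/-- Incremental Lyapunov functions yield incremental exponential stability. -/
theorem IsIncrementalLyapunov.isIncrementallyExpStable {p : Params} {h : ℝ → ℝ} {ε l L : ℝ}
    {P : Matrix (Fin 3) (Fin 3) ℝ} (hV : IsIncrementalLyapunov p h P ε) (hl : 0 < l) (hL : 0 < L)
    (hP : ∀ z : EuclideanSpace ℝ (Fin 3),
      l * ‖z‖ ^ 2 ≤ quadForm P z ∧ quadForm P z ≤ L * ‖z‖ ^ 2) :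
    IsIncrementallyExpStable p h √(L / l) (ε / 2) := by
  intro m I hI x x' hx hx' s hs t ht hst
  have h1 := le_exp_mul_of_deriv_le hI (hV m I hI x x' hx hx') hs ht hst
  refine le_of_sq_le_sq ?_ (by positivity)
  have e : Real.exp (-ε * (t - s)) = Real.exp (-(ε / 2) * (t - s)) ^ 2 := by
    rw [← Real.exp_nat_mul]; congr 1; push_cast; ring
  have h2 : l * ‖x t - x' t‖ ^ 2 ≤ Real.exp (-ε * (t - s)) * (L * ‖x s - x' s‖ ^ 2) :=
    (hP _).1.trans (h1.trans (by gcongr; exact (hP _).2))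
  rw [mul_pow, mul_pow, Real.sq_sqrt (by positivity), ← e]
  rw [mul_comm l, ← le_div_iff₀ hl] at h2
  refine h2.trans_eq ?_
  ring

end FinRoll

theorem mainTheorem1 (p : FinRoll.Params) (kf : ℝ)
    (hn : 0 < p.n) (hω₀ : 0 < p.ω₀) (hc : 0 < p.c) (hkf : 0 < kf)
    (hfreq : ∀ ω : ℝ, 0 < (FinRoll.Wtilde p (Complex.I * (ω : ℂ))).re + 1 / kf) :
    ∃ (P : Matrix (Fin 3) (Fin 3) ℝ) (ε K : ℝ), P.PosDef ∧ 0 < ε ∧ 0 < K ∧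
      ∀ h : ℝ → ℝ, FinRoll.SlopeRestricted kf h →
        FinRoll.IsIncrementalLyapunov p h P ε ∧
        FinRoll.IsIncrementallyExpStable p h K (ε / 2) := by
  obtain ⟨P, ε, hP, hε, hS⟩ := FinRoll.exists_storage hn hω₀ hc hkf hfreq
  have hPD := hS.posDef hn hω₀ hc hP hε
  obtain ⟨l, L, hl, hL, hlL⟩ := FinRoll.exists_quadForm_bounds hPD
  refine ⟨P, ε / L, √(L / l), hPD, by positivity, by positivity, fun h hh => ?_⟩
  have hV := hS.isIncrementalLyapunov hP hkf hε hL (fun z => (hlL z).2) hh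
  exact ⟨hV, hV.isIncrementallyExpStable hl hL hlL⟩
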